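/- Let $I=[0,1]$ with Lebesgue measure $m$. For $f:I\to\mathbb R$ and $r>0$ put $$\operatorname{Osc}(f,r,x)=\sup\{|f(y_1)-f(y_2)| : y_1,y_2\in(x-r,x+r)\cap I\},\qquad \operatorname{Osc}_1(f,r)=\int_I\operatorname{Osc}(f,r,x)\,dm(x),$$ and, for $1\le p<\infty$, let $BV_{1,1/p}(I)$ be the space of all $f\in L^1(I)$ with $$\operatorname{var}_{1,1/p}(f)=\sup_{0<r\le1}\frac{\operatorname{Osc}_1(f,r)}{r^{1/p}}<\infty .$$ Let $s>1$ and $\varepsilon>0$, and let $\tau\in\mathcal T([0,1];s,\varepsilon)$, that is, $\tau:I\to I$ and there is a finite partition $0=a_0<a_1<\dots<a_N=1$ such that, for each $i=1,\dots,N$, on $(a_{i-1},a_i)$ the map $\tau$ is monotone and $C^1$, extends continuously to $[a_{i-1},a_i]$, satisfies $|\tau'|\ge s$, and has $\varepsilon$-Hölder continuous derivative. Let $P_\tau:L^1(I)\to L^1(I)$ be its Frobenius–Perron operator, characterized by $\int_A P_\tau f\,dm=\int_{\tau^{-1}(A)}f\,dm$ for all Borel sets $A\subset I$. Let $q:\mathbb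 R\to[0,\infty)$ be a $C^1$ function with $\operatorname{supp}q\subset[-1,1]$ and $\int_{\mathbb R}q=1$. For $\delta>0$ put $$q_\delta^{\mathrm{per}}(x,y)=\sum_{n\in\mathbb Z}\delta^{-1}q\Bigl(\frac{x-y+n}{\delta}\Bigr),\qquad (Q_\delta f)(x)=\int_I q_\delta^{\mathrm{per}}(x,y)f(y)\,dy,\qquad P_\delta=Q_\delta P_\tau .$$ Then, for every $1\le p<\infty$ and every $\delta>0$, there is a function $h_\delta\in BV_{1,1/p}(I)$ such that $$P_\delta h_\delta=h_\delta,\qquad h_\delta\ge0,\qquad \|h_\delta\|_1=1,$$ where the first two relations hold at every point of $I$. -/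

import Mathlib

open MeasureTheory Set

open scoped ENNReal unitInterval

noncomputable section

namespace ExpandingMap

/-- `Osc(f, r, x) = sup { |f y₁ - f y₂| : y₁, y₂ ∈ (x - r, x + r) ∩ I }`, with values in `[0, ∞]`.
The ball of the metric space `I = [0,1]` is `(x - r, x + r) ∩ I`. -/
def osc (f : I → ℝ) (r : ℝ) (x : I) : ℝ≥0∞ :=
  ⨆ y₁ ∈ Metric.ball x r, ⨆ y₂ ∈ Metric.ball x r, ENNReal.ofReal |f y₁ - f y₂|

/-- `Osc₁(f, r) = ∫_I Osc(f, r, x) dm(x)`. -/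
def oscOne (f : I → ℝ) (r : ℝ) : ℝ≥0∞ :=
  ∫⁻ x : I, osc f r x

/-- `var_{1,1/p}(f) = sup_{0 < r ≤ 1} Osc₁(f, r) / r^{1/p}`, with values in `[0, ∞]`. -/
def var (p : ℝ) (f : I → ℝ) : ℝ≥0∞ :=
  ⨆ r ∈ Ioc (0 : ℝ) 1, oscOne f r / ENNReal.ofReal (r ^ (1 / p))

/-- `f` belongs to `BV_{1,1/p}(I)`: it is integrable on `I` and `var_{1,1/p}(f) < ∞`. -/
structure MemBV (p : ℝ) (f : I → ℝ) : Prop where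
  integrable : Integrable f (volume : Measure I)
  var_lt_top : var p f < ∞

/-- A self-map of `I = [0,1]` as a real function: it is `τ` on `[0,1]`, and constant on each side
of `[0,1]`. Only its values on `[0,1]` and its derivatives inside `(0,1)` are used. -/
def realMap (τ : I → I) (x : ℝ) : ℝ :=
  (τ (projIcc 0 1 zero_le_one x) : ℝ)

/-- The class `𝒯([0,1]; s, ε)` of piecewise expanding `C^{1+ε}` maps of `[0,1]`: there is a finite
partition `0 = a₀ < a₁ < ⋯ < a_N = 1` such that on each `(a_{i-1}, a_i)` the map is monotone,
of class `C¹`, extends continuously to `[a_{i-1}, a_i]`, satisfies `|τ'| ≥ s > 1`, and `τ'` is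
`ε`-Hölder continuous. -/
structure MemT (s ε : ℝ) (τ : I → I) : Prop where
  one_lt : 1 < s
  exists_partition : ∃ (N : ℕ) (a : Fin (N + 1) → ℝ),
    StrictMono a ∧ a 0 = 0 ∧ a (Fin.last N) = 1 ∧
    ∀ i : Fin N,
      (MonotoneOn (realMap τ) (Ioo (a i.castSucc) (a i.succ)) ∨
        AntitoneOn (realMap τ) (Ioo (a i.castSucc) (a i.succ))) ∧
      ContDiffOn ℝ 1 (realMap τ) (Ioo (a i.castSucc) (a i.succ)) ∧
      (∃ g : ℝ → ℝ, ContinuousOn g (Icc (a i.castSucc) (a i.succ)) ∧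
        EqOn (realMap τ) g (Ioo (a i.castSucc) (a i.succ))) ∧
      (∀ x ∈ Ioo (a i.castSucc) (a i.succ), s ≤ |deriv (realMap τ) x|) ∧
      (∃ H : ℝ, ∀ x ∈ Ioo (a i.castSucc) (a i.succ), ∀ y ∈ Ioo (a i.castSucc) (a i.succ),
        |deriv (realMap τ) x - deriv (realMap τ) y| ≤ H * |x - y| ^ ε)

/-- The Frobenius–Perron operator `P_τ`: for integrable `f`, `P_τ f` is the Radon–Nikodym
derivative, with respect to Lebesgue measure on `I`, of the push-forward by `τ` of the signed
measure `f dm`; that is, `∫_A P_τ f dm = ∫_{τ⁻¹ A} f dm` for all Borel sets `A`, whenever `τ` is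
measurable and nonsingular, as all maps in `𝒯([0,1]; s, ε)` are. -/
def frobeniusPerron (τ : I → I) (f : I → ℝ) : I → ℝ :=
  SignedMeasure.rnDeriv (((volume : Measure I).withDensityᵥ f).map τ) (volume : Measure I)

/-- The noise densities: `q : ℝ → [0, ∞)` of class `C¹`, supported in `[-1, 1]`, of integral one. -/
structure IsNoiseKernel (q : ℝ → ℝ) : Prop where
  contDiff : ContDiff ℝ 1 q
  nonneg : ∀ z, 0 ≤ q z
  tsupport_subset : tsupport q ⊆ Icc (-1) 1
  integral_eq_one : ∫ z, q z = 1

/-- The periodized kernel `q_δ^per(x, y) = ∑_{n ∈ ℤ} δ⁻¹ q((x - y + n) / δ)`. For `δ > 0` and `q`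
of compact support only finitely many terms are nonzero. -/
def periodizedKernel (q : ℝ → ℝ) (δ : ℝ) (x y : I) : ℝ :=
  ∑' n : ℤ, δ⁻¹ * q (((x : ℝ) - (y : ℝ) + (n : ℝ)) / δ)

/-- The smoothing operator `(Q_δ f)(x) = ∫_I q_δ^per(x, y) f(y) dy`. -/
def smoothing (q : ℝ → ℝ) (δ : ℝ) (f : I → ℝ) : I → ℝ :=
  fun x => ∫ y : I, periodizedKernel q δ x y * f y

/-- The perturbed Frobenius–Perron operator `P_δ = Q_δ P_τ`. -/
def perturbedFP (τ : I → I) (q : ℝ → ℝ) (δ : ℝ) (f : I → ℝ) : I → ℝ :=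
  smoothing q δ (frobeniusPerron τ f)

end ExpandingMap

end

namespace ExpandingMap

open Filter Topology BoundedContinuousFunction

open scoped NNReal

/-! Fix `x` and test `P_τ h` against the kernel: by duality (`integral_mul_frobeniusPerron`), for an
integrable measurable `h ≥ 0`, `P_δ h (x) = ∫ K(x, z) h(z) dz` with `K(x, z) = q_δ^per(x, τ z)`.
This `K` is bounded, Lipschitz in `x` uniformly in `z`, and has `∫ K(x, z) dx = 1`. Hence the
operator sends every continuous density to a density with fixed sup and Lipschitz bounds. Such
densities form a convex set, compact in the uniform norm by Arzelà–Ascoli, and Birkhoff averages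
produce a fixed point (`exists_invariant_density`). Lipschitz functions lie in every `BV_{1,1/p}`.
No Lasota–Yorke inequality is needed: expansion only serves to make `τ` nonsingular. -/

/-- A continuous linear map preserving a nonempty compact convex set has a fixed point there. -/
theorem exists_fixedPoint_of_isCompact_convex {E : Type*} [NormedAddCommGroup E] [NormedSpace ℝ E]
    {S : Set E} (hS : IsCompact S) (hc : Convex ℝ S) (hne : S.Nonempty) (T : E →L[ℝ] E)
    (hT : MapsTo T S S) : ∃ x ∈ S, T x = x := by
  obtain ⟨x₀, hx₀⟩ := hne
  have horb : ∀ n, T^[n] x₀ ∈ S := fun n => hT.iterate n hx₀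
  -- The shift to `n + 1` avoids the empty average, which is `0` and may lie outside `S`.
  have hA : ∀ n : ℕ, birkhoffAverage ℝ T id (n + 1) x₀ ∈ S := by
    intro n
    rw [birkhoffAverage, birkhoffSum, Finset.smul_sum]
    refine hc.sum_mem (fun _ _ => by positivity) ?_ (fun k _ => horb k)
    rw [Finset.sum_const, Finset.card_range, nsmul_eq_mul, mul_inv_cancel₀ (by positivity)]
  obtain ⟨a, ha, φ, hφ, hlim⟩ := hS.tendsto_subseq hA
  refine ⟨a, ha, ?_⟩
  -- The averages at `T x₀` and `x₀` differ by a telescoped boundary term over `n`, which tends to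
  -- `0` because the orbit is bounded.
  have hdiff := (tendsto_birkhoffAverage_apply_sub_birkhoffAverage ℝ (f := T) (g := id) (x := x₀)
    (hS.isBounded.subset (range_subset_iff.2 horb))).comp
      ((tendsto_add_atTop_nat 1).comp hφ.tendsto_atTop)
  have hcomm : ∀ n, birkhoffAverage ℝ T id n (T x₀) = T (birkhoffAverage ℝ T id n x₀) := by
    intro n
    rw [map_birkhoffAverage ℝ ℝ T T id n x₀]
    simp only [birkhoffAverage, birkhoffSum, Function.comp_apply, id_eq,
      ← Function.iterate_succ_apply, Function.iterate_succ_apply']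
  have hTlim := ((T.continuous.tendsto a).comp hlim).sub hlim
  refine sub_eq_zero.1 (tendsto_nhds_unique hTlim (hdiff.congr fun n => ?_))
  simp [hcomm]

/-! ### Lipschitz Markov kernels on a compact space -/

section MarkovKernel

variable {X : Type*} [MetricSpace X] [MeasurableSpace X] [BorelSpace X]
  {μ : Measure X} {K : X → X → ℝ} {C : ℝ} {L : ℝ≥0}

theorem integrable_kernel_mul [IsFiniteMeasure μ] (hK : Measurable (Function.uncurry K))
    (hbound : ∀ x z, K x z ∈ Icc 0 C) (f : X →ᵇ ℝ) (x : X) :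
    Integrable (fun z => K x z * f z) μ := by
  refine (f.integrable μ).bdd_mul (c := C)
    (hK.comp measurable_prodMk_left).aestronglyMeasurable (ae_of_all _ fun z => ?_)
  rw [Real.norm_eq_abs, abs_of_nonneg (hbound x z).1]
  exact (hbound x z).2

theorem dist_integral_kernel_mul_le [IsFiniteMeasure μ] (hK : Measurable (Function.uncurry K))
    (hbound : ∀ x z, K x z ∈ Icc 0 C) (hlip : ∀ z, LipschitzWith L fun x => K x z) (f : X →ᵇ ℝ)
    (x y : X) :
    dist (∫ z, K x z * f z ∂μ) (∫ z, K y z * f z ∂μ) ≤ L * (∫ z, |f z| ∂μ) * dist x y := by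
  rw [dist_eq_norm, ← integral_sub (integrable_kernel_mul hK hbound f x)
    (integrable_kernel_mul hK hbound f y)]
  calc _ ≤ ∫ z, L * dist x y * |f z| ∂μ := by
        refine norm_integral_le_of_norm_le ((f.integrable μ).abs.const_mul _)
          (ae_of_all _ fun z => ?_)
        rw [← sub_mul, norm_mul, Real.norm_eq_abs (f z), ← dist_eq_norm]
        exact mul_le_mul_of_nonneg_right ((hlip z).dist_le_mul x y) (abs_nonneg _)
    _ = _ := by rw [integral_const_mul]; ring

theorem abs_integral_kernel_mul_le [IsFiniteMeasure μ]
    (hbound : ∀ x z, K x z ∈ Icc 0 C) (f : X →ᵇ ℝ) (x : X) :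
    |∫ z, K x z * f z ∂μ| ≤ C * ∫ z, |f z| ∂μ := by
  rw [← Real.norm_eq_abs, ← integral_const_mul]
  refine norm_integral_le_of_norm_le ((f.integrable μ).abs.const_mul _) (ae_of_all _ fun z => ?_)
  rw [norm_mul, Real.norm_eq_abs, Real.norm_eq_abs, abs_of_nonneg (hbound x z).1]
  exact mul_le_mul_of_nonneg_right (hbound x z).2 (abs_nonneg _)

theorem integral_abs_le_norm [IsProbabilityMeasure μ] (f : X →ᵇ ℝ) : ∫ z, |f z| ∂μ ≤ ‖f‖ := by
  calc _ ≤ ∫ _, ‖f‖ ∂μ := integral_mono (f.integrable μ).abs (integrable_const _)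
        fun z => f.norm_coe_le_norm z
    _ = _ := by simp

variable [CompactSpace X]

/-- The operator `f ↦ ∫ K(·, z) f(z) dμ(z)` on bounded continuous functions. -/
noncomputable def kernelOperator [IsProbabilityMeasure μ] (hK : Measurable (Function.uncurry K))
    (hbound : ∀ x z, K x z ∈ Icc 0 C) (hlip : ∀ z, LipschitzWith L fun x => K x z) :
    (X →ᵇ ℝ) →L[ℝ] (X →ᵇ ℝ) :=
  LinearMap.mkContinuous
    { toFun := fun f => mkOfCompact ⟨fun x => ∫ z, K x z * f z ∂μ,
        (LipschitzWith.of_dist_le_mul (K := L * ⟨∫ z, |f z| ∂μ, by positivity⟩)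
          fun x y => dist_integral_kernel_mul_le hK hbound hlip f x y).continuous⟩
      map_add' := fun f g => by
        ext x
        simpa [mul_add] using integral_add (integrable_kernel_mul (μ := μ) hK hbound f x)
          (integrable_kernel_mul hK hbound g x)
      map_smul' := fun c f => by
        ext x
        simp [← integral_const_mul, mul_left_comm] }
    |C| fun f => by
      refine (norm_le (by positivity)).2 fun x => (abs_integral_kernel_mul_le hbound f x).trans ?_
      exact mul_le_mul (le_abs_self C) (integral_abs_le_norm f) (by positivity) (abs_nonneg C)

@[simp]
theorem kernelOperator_apply [IsProbabilityMeasure μ] (hK : Measurable (Function.uncurry K))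
    (hbound : ∀ x z, K x z ∈ Icc 0 C) (hlip : ∀ z, LipschitzWith L fun x => K x z) (f : X →ᵇ ℝ)
    (x : X) : kernelOperator (μ := μ) hK hbound hlip f x = ∫ z, K x z * f z ∂μ := rfl

theorem integral_kernelOperator [IsProbabilityMeasure μ] (hK : Measurable (Function.uncurry K))
    (hbound : ∀ x z, K x z ∈ Icc 0 C) (hlip : ∀ z, LipschitzWith L fun x => K x z)
    (hone : ∀ z, ∫ x, K x z ∂μ = 1) (f : X →ᵇ ℝ) :
    ∫ x, kernelOperator (μ := μ) hK hbound hlip f x ∂μ = ∫ z, f z ∂μ := by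
  simp only [kernelOperator_apply]
  rw [integral_integral_swap]
  · simp [integral_mul_const, hone]
  · refine ((f.integrable μ).comp_snd μ).bdd_mul (c := C) hK.aestronglyMeasurable
      (ae_of_all _ fun z => ?_)
    rw [Real.norm_eq_abs, abs_of_nonneg (hbound _ _).1]
    exact (hbound _ _).2

/-- A bounded Markov kernel that is uniformly Lipschitz in its first variable has a Lipschitz
invariant density. -/
theorem exists_invariant_density [IsProbabilityMeasure μ] (hK : Measurable (Function.uncurry K))
    (hbound : ∀ x z, K x z ∈ Icc 0 C) (hlip : ∀ z, LipschitzWith L fun x => K x z)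
    (hone : ∀ z, ∫ x, K x z ∂μ = 1) :
    ∃ h : X → ℝ, LipschitzWith L h ∧ (∀ x, 0 ≤ h x) ∧ ∫ x, h x ∂μ = 1 ∧
      ∀ x, ∫ z, K x z * h z ∂μ = h x := by
  let T := kernelOperator (μ := μ) hK hbound hlip
  let S : Set (X →ᵇ ℝ) := {f | (∀ x, f x ∈ Icc 0 C) ∧ LipschitzWith L f ∧ ∫ x, f x ∂μ = 1}
  have heval : ∀ x, Continuous fun f : X →ᵇ ℝ => f x := fun x => continuous_eval_const x
  have hcint : Continuous fun f : X →ᵇ ℝ => ∫ x, f x ∂μ := by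
    refine LipschitzWith.continuous (K := 1) (LipschitzWith.of_dist_le_mul fun f g => ?_)
    rw [dist_eq_norm, dist_eq_norm, ← integral_sub (f.integrable μ) (g.integrable μ),
      NNReal.coe_one, one_mul]
    exact (norm_integral_le_integral_norm _).trans (integral_abs_le_norm (f - g))
  -- The sup and Lipschitz bounds of `T f` scale with the `L¹` norm of `f`, here `1`. No regularity
  -- of `f` enters, so `T 1` witnesses that `S` is nonempty.
  have hTS : ∀ f : X →ᵇ ℝ, (∀ x, 0 ≤ f x) → ∫ x, f x ∂μ = 1 → T f ∈ S := by
    intro f hf hf1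
    have habs : ∫ x, |f x| ∂μ = 1 := by simpa only [abs_of_nonneg (hf _)] using hf1
    refine ⟨fun x => ⟨integral_nonneg fun z => mul_nonneg (hbound x z).1 (hf z), ?_⟩,
      LipschitzWith.of_dist_le_mul fun x y => ?_,
      (integral_kernelOperator hK hbound hlip hone f).trans hf1⟩
    · have := (le_abs_self _).trans (abs_integral_kernel_mul_le (μ := μ) hbound f x)
      rwa [habs, mul_one] at this
    · have := dist_integral_kernel_mul_le (μ := μ) hK hbound hlip f x y
      rwa [habs, mul_one] at this
  have hclosed : IsClosed S := by
    have h1 : IsClosed {f : X →ᵇ ℝ | ∀ x, f x ∈ Icc 0 C} := by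
      simp only [ofPred_forall]
      exact isClosed_iInter fun x => isClosed_Icc.preimage (heval x)
    have h2 : IsClosed {f : X →ᵇ ℝ | LipschitzWith L f} := by
      simp only [lipschitzWith_iff_dist_le_mul, ofPred_forall]
      exact isClosed_iInter fun x => isClosed_iInter fun y =>
        isClosed_le ((heval x).dist (heval y)) continuous_const
    exact h1.inter (h2.inter (isClosed_singleton.preimage hcint))
  have hcompact : IsCompact S := arzela_ascoli₂ (Icc 0 C) isCompact_Icc S hclosed
    (fun f x hf => hf.1 x)
    (LipschitzWith.uniformEquicontinuous _ L fun f => f.2.2.1).equicontinuous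
  have hconvex : Convex ℝ S := by
    rintro f ⟨hf, hfL, hf1⟩ g ⟨hg, hgL, hg1⟩ a b ha hb hab
    refine ⟨fun x => convex_Icc 0 C (hf x) (hg x) ha hb hab,
      LipschitzWith.of_dist_le_mul fun x y => ?_, ?_⟩
    · have hx := hfL.dist_le_mul x y
      have hy := hgL.dist_le_mul x y
      rw [Real.dist_eq] at hx hy ⊢
      calc |a * f x + b * g x - (a * f y + b * g y)|
          = |a * (f x - f y) + b * (g x - g y)| := by ring_nf
        _ ≤ a * |f x - f y| + b * |g x - g y| := by
          simpa [abs_mul, abs_of_nonneg ha, abs_of_nonneg hb]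
            using abs_add_le (a * (f x - f y)) (b * (g x - g y))
        _ ≤ a * (L * dist x y) + b * (L * dist x y) := by gcongr
        _ = L * dist x y := by rw [← add_mul, hab, one_mul]
    · calc ∫ x, (a * f x + b * g x) ∂μ = a * ∫ x, f x ∂μ + b * ∫ x, g x ∂μ := by
            rw [integral_add ((f.integrable μ).const_mul a) ((g.integrable μ).const_mul b),
              integral_const_mul, integral_const_mul]
        _ = 1 := by rw [hf1, hg1, mul_one, mul_one, hab]
  obtain ⟨h, hS, hh⟩ := exists_fixedPoint_of_isCompact_convex hcompact hconvex
    ⟨T 1, hTS 1 (fun _ => zero_le_one) (by simp)⟩ T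
    fun f hf => hTS f (fun x => (hf.1 x).1) hf.2.2
  exact ⟨h, hS.2.1, fun x => (hS.1 x).1, hS.2.2, fun x => DFunLike.congr_fun hh x⟩

end MarkovKernel

/-! ### Measurability and nonsingularity of the map -/

theorem exists_mem_Ioo_of_notMem_range {N : ℕ} (a : Fin (N + 1) → ℝ) {x : ℝ} (h0 : a 0 ≤ x)
    (h1 : x ≤ a (Fin.last N)) (hx : x ∉ range a) :
    ∃ i : Fin N, x ∈ Ioo (a i.castSucc) (a i.succ) := by
  by_contra! hcon
  have key : ∀ i, a i < x := by
    intro i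
    induction i using Fin.induction with
    | zero => exact h0.lt_of_ne fun h => hx ⟨0, h⟩
    | succ i ih =>
      exact (not_lt.1 fun h => hcon i ⟨ih, h⟩).lt_of_ne fun h => hx ⟨_, h⟩
  exact (key (Fin.last N)).not_ge h1

theorem realMap_coe (τ : I → I) (x : I) : realMap τ x = τ x := by
  simp [realMap]

/-- Off the finitely many partition points `τ` is continuous; on them its values are arbitrary, but
any function on a finite set is measurable. -/
theorem measurable_of_memT {s ε : ℝ} {τ : I → I} (hτ : MemT s ε τ) : Measurable τ := by
  obtain ⟨N, a, -, h0, h1, ha⟩ := hτ.exists_partition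
  have hcov : ∀ x : I, (x : ℝ) ∉ range a → ∃ i : Fin N, (x : ℝ) ∈ Ioo (a i.castSucc) (a i.succ) :=
    fun x hx => exists_mem_Ioo_of_notMem_range a (h0 ▸ x.2.1) (h1 ▸ x.2.2) hx
  have hfin : ((↑) ⁻¹' range a : Set I).Finite :=
    (finite_range a).preimage Subtype.val_injective.injOn
  refine measurable_of_restrict_of_restrict_compl hfin.measurableSet ?_ ?_
  · have := hfin.to_subtype
    exact measurable_of_finite _
  · refine Continuous.measurable (continuousOn_iff_continuous_domRestrict.1 fun x hx => ?_)
    obtain ⟨i, hi⟩ := hcov x hx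
    have hc : ContinuousAt (fun y : I => realMap τ y) x :=
      ((ha i).2.1.continuousOn.continuousAt (isOpen_Ioo.mem_nhds hi)).comp
        continuous_subtype_val.continuousAt
    simp only [realMap_coe] at hc
    exact (Topology.IsInducing.subtypeVal.continuousAt_iff.2 hc).continuousWithinAt

theorem measurable_realMap {τ : I → I} (hτ : Measurable τ) : Measurable (realMap τ) :=
  measurable_subtype_coe.comp (hτ.comp continuous_projIcc.measurable)

/-- The preimage of a null set by a function whose derivative is bounded away from zero on an
open interval is null in that interval. -/
theorem volume_Ioo_inter_preimage_eq_zero {t : ℝ → ℝ} (ht : Measurable t) {a b s : ℝ} (hs : 0 < s)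
    (hd : DifferentiableOn ℝ t (Ioo a b)) (hbd : ∀ x ∈ Ioo a b, s ≤ |deriv t x|) {A : Set ℝ}
    (hA : MeasurableSet A) (hA0 : volume A = 0) : volume (Ioo a b ∩ t ⁻¹' A) = 0 := by
  have hdat : ∀ x ∈ Ioo a b, DifferentiableAt ℝ t x :=
    fun x hx => (hd x hx).differentiableAt (isOpen_Ioo.mem_nhds hx)
  -- Rolle's theorem: a repeated value would force a zero of the derivative.
  have hlt : ∀ x ∈ Ioo a b, ∀ y ∈ Ioo a b, x < y → t x ≠ t y := by
    intro x hx y hy hxy heq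
    have hsub : Icc x y ⊆ Ioo a b := Icc_subset_Ioo hx.1 hy.2
    obtain ⟨c, hc, hc0⟩ := exists_deriv_eq_zero hxy (hd.continuousOn.mono hsub) heq
    have := hbd c (hsub (Ioo_subset_Icc_self hc))
    rw [hc0, abs_zero] at this
    exact hs.not_ge this
  have hinj : InjOn t (Ioo a b) := by
    intro x hx y hy hxy
    rcases lt_trichotomy x y with h | h | h
    · exact absurd hxy (hlt x hx y hy h)
    · exact h
    · exact absurd hxy.symm (hlt y hy x hx h)
  have hB : MeasurableSet (Ioo a b ∩ t ⁻¹' A) := measurableSet_Ioo.inter (ht hA)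
  -- With `B` the set to be shown null, change of variables gives `s |B| ≤ ∫_B |t'| = |t(B)| ≤ |A| =
  -- 0`.
  have hcv := lintegral_image_eq_lintegral_abs_deriv_mul hB
    (fun x hx => (hdat x hx.1).hasDerivAt.hasDerivWithinAt) (hinj.mono inter_subset_left) 1
  have himg : volume (t '' (Ioo a b ∩ t ⁻¹' A)) = 0 :=
    measure_mono_null (by rintro _ ⟨x, hx, rfl⟩; exact hx.2) hA0
  simp only [Pi.one_apply, mul_one, setLIntegral_one, himg] at hcv
  have hle : ENNReal.ofReal s * volume (Ioo a b ∩ t ⁻¹' A) ≤ 0 := by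
    rw [hcv, ← setLIntegral_const]
    exact setLIntegral_mono' hB fun x hx => ENNReal.ofReal_le_ofReal (hbd x hx.1)
  exact (mul_eq_zero.1 (le_zero_iff.1 hle)).resolve_left (by simpa using hs)

theorem map_volume_absolutelyContinuous {s ε : ℝ} {τ : I → I} (hτ : MemT s ε τ) :
    (volume : Measure I).map τ ≪ volume := by
  have hm := measurable_of_memT hτ
  obtain ⟨N, a, -, h0, h1, ha⟩ := hτ.exists_partition
  refine Measure.AbsolutelyContinuous.mk fun A hA hA0 => ?_
  rw [Measure.map_apply hm hA, unitInterval.volume_apply]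
  rw [unitInterval.volume_apply] at hA0
  refine measure_mono_null (t := range a ∪
    ⋃ i : Fin N, Ioo (a i.castSucc) (a i.succ) ∩ realMap τ ⁻¹' (Subtype.val '' A)) ?_ ?_
  · rintro _ ⟨x, hx, rfl⟩
    by_cases hxa : (x : ℝ) ∈ range a
    · exact Or.inl hxa
    · obtain ⟨i, hi⟩ :=
        exists_mem_Ioo_of_notMem_range a (h0 ▸ x.2.1) (h1 ▸ x.2.2) hxa
      exact Or.inr (mem_iUnion.2 ⟨i, hi, τ x, hx, (realMap_coe τ x).symm⟩)
  · refine measure_union_null ((finite_range a).measure_zero _) (measure_iUnion_null fun i => ?_)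
    exact volume_Ioo_inter_preimage_eq_zero (measurable_realMap hm)
      (zero_lt_one.trans hτ.one_lt) ((ha i).2.1.differentiableOn one_ne_zero) (ha i).2.2.2.1
      (measurableSet_Icc.subtype_image hA) hA0

/-! ### Duality for the Frobenius–Perron operator -/

theorem frobeniusPerron_ae_eq {τ : I → I} (hm : Measurable τ)
    (hac : (volume : Measure I).map τ ≪ volume) {f : I → ℝ} (hf : Integrable f volume)
    (hf0 : ∀ x, 0 ≤ f x) :
    frobeniusPerron τ f =ᵐ[volume] fun y => ((((volume : Measure I).withDensity
      fun x => ENNReal.ofReal (f x)).map τ).rnDeriv volume y).toReal := by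
  have := isFiniteMeasure_withDensity_ofReal hf.2
  have hνac : ((volume : Measure I).withDensity fun x => ENNReal.ofReal (f x)).map τ ≪ volume :=
    ((withDensity_absolutelyContinuous _ _).map hm).trans hac
  -- Uniqueness of the Lebesgue decomposition, with zero singular part by nonsingularity.
  refine (SignedMeasure.eq_rnDeriv 0 _ Measure.integrable_toReal_rnDeriv
    VectorMeasure.MutuallySingular.zero_left ?_).symm
  ext A hA
  rw [zero_add, withDensityᵥ_apply Measure.integrable_toReal_rnDeriv hA,
    VectorMeasure.map_apply _ hm hA, withDensityᵥ_apply hf (hm hA),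
    Measure.setIntegral_toReal_rnDeriv hνac, Measure.real, Measure.map_apply hm hA,
    withDensity_apply _ (hm hA), integral_eq_lintegral_of_nonneg_ae (ae_of_all _ hf0)
      hf.aestronglyMeasurable.restrict]

/-- Duality between the Frobenius–Perron operator and composition with the map. -/
theorem integral_mul_frobeniusPerron {τ : I → I} (hm : Measurable τ)
    (hac : (volume : Measure I).map τ ≪ volume) {f : I → ℝ} (hfm : Measurable f)
    (hf : Integrable f volume) (hf0 : ∀ x, 0 ≤ f x) {g : I → ℝ} (hg : Measurable g) :
    ∫ y, g y * frobeniusPerron τ f y = ∫ z, g (τ z) * f z := by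
  have := isFiniteMeasure_withDensity_ofReal hf.2
  have hνac : ((volume : Measure I).withDensity fun x => ENNReal.ofReal (f x)).map τ ≪ volume :=
    ((withDensity_absolutelyContinuous _ _).map hm).trans hac
  calc ∫ y, g y * frobeniusPerron τ f y
      = ∫ y, ((((volume : Measure I).withDensity
          fun x => ENNReal.ofReal (f x)).map τ).rnDeriv volume y).toReal * g y := by
        refine integral_congr_ae ?_
        filter_upwards [frobeniusPerron_ae_eq hm hac hf hf0] with y hy
        rw [hy, mul_comm]
    _ = ∫ z, g (τ z) ∂(volume : Measure I).withDensity fun x => ENNReal.ofReal (f x) := by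
        rw [integral_toReal_rnDeriv_mul hνac,
          integral_map hm.aemeasurable hg.aestronglyMeasurable]
    _ = ∫ z, g (τ z) * f z := by
        rw [integral_withDensity_eq_integral_toReal_smul hfm.ennreal_ofReal
          (ae_of_all _ fun _ => ENNReal.ofReal_lt_top)]
        simp [ENNReal.toReal_ofReal (hf0 _), mul_comm]

/-! ### The periodized kernel -/

theorem IsNoiseKernel.eq_zero {q : ℝ → ℝ} (hq : IsNoiseKernel q) {u : ℝ} (hu : 1 < |u|) :
    q u = 0 := by
  refine image_eq_zero_of_notMem_tsupport fun h => hu.not_ge (abs_le.2 ?_)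
  exact hq.tsupport_subset h

theorem IsNoiseKernel.hasCompactSupport {q : ℝ → ℝ} (hq : IsNoiseKernel q) :
    HasCompactSupport q :=
  isCompact_Icc.of_isClosed_subset (isClosed_tsupport q) hq.tsupport_subset

/-- If `|n| ≥ ⌈δ⌉ + 2` and `|u| ≤ 1`, then `|u + n| ≥ ⌈δ⌉ + 1 > δ`. One finite index range thus
serves all `x`, `y`. -/
theorem IsNoiseKernel.div_eq_zero {q : ℝ → ℝ} (hq : IsNoiseKernel q) {δ : ℝ} (hδ : 0 < δ) {u : ℝ}
    (hu : u ∈ Icc (-1 : ℝ) 1) {n : ℤ} (hn : n ∉ Finset.Icc (-(⌈δ⌉ + 1)) (⌈δ⌉ + 1)) :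
    q ((u + n) / δ) = 0 := by
  refine hq.eq_zero ?_
  rw [abs_div, abs_of_pos hδ, lt_div_iff₀ hδ, one_mul, lt_abs]
  have hc := Int.le_ceil δ
  simp only [Finset.mem_Icc, not_and_or, not_le] at hn
  rcases hn with hn | hn
  · have : (n : ℝ) + 1 ≤ -(⌈δ⌉ + 1) := by exact_mod_cast hn
    right; linarith [hu.2]
  · have : (⌈δ⌉ : ℝ) + 1 + 1 ≤ n := by exact_mod_cast hn
    left; linarith [hu.1]

/-- The periodized kernel as a finite sum, in terms of the difference of its arguments. -/
noncomputable def periodizedProfile (q : ℝ → ℝ) (δ u : ℝ) : ℝ :=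
  ∑ n ∈ Finset.Icc (-(⌈δ⌉ + 1)) (⌈δ⌉ + 1), δ⁻¹ * q ((u + (n : ℝ)) / δ)

theorem sub_mem_Icc (x y : I) : (x : ℝ) - y ∈ Icc (-1 : ℝ) 1 :=
  ⟨by linarith [x.2.1, y.2.2], by linarith [x.2.2, y.2.1]⟩

theorem periodizedKernel_eq {q : ℝ → ℝ} (hq : IsNoiseKernel q) {δ : ℝ} (hδ : 0 < δ) (x y : I) :
    periodizedKernel q δ x y = periodizedProfile q δ (x - y) :=
  tsum_eq_sum fun n hn => by rw [hq.div_eq_zero hδ (sub_mem_Icc x y) hn, mul_zero]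

theorem contDiff_periodizedProfile {q : ℝ → ℝ} (hq : IsNoiseKernel q) (δ : ℝ) :
    ContDiff ℝ 1 (periodizedProfile q δ) :=
  ContDiff.sum fun _ _ => contDiff_const.mul
    (hq.contDiff.comp ((contDiff_id.add contDiff_const).div_const δ))

theorem periodizedProfile_nonneg {q : ℝ → ℝ} (hq : IsNoiseKernel q) {δ : ℝ} (hδ : 0 < δ) (u : ℝ) :
    0 ≤ periodizedProfile q δ u :=
  Finset.sum_nonneg fun _ _ => mul_nonneg (inv_nonneg.2 hδ.le) (hq.nonneg _)

/-- Unfolding: the translates of `[-y, -y + 1]` by integers tile the line, so the terms add up to `∫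
δ⁻¹ q(v / δ) dv = 1`. -/
theorem integral_periodizedKernel {q : ℝ → ℝ} (hq : IsNoiseKernel q) {δ : ℝ} (hδ : 0 < δ) (y : I) :
    ∫ x : I, periodizedKernel q δ x y = 1 := by
  have hint : Integrable fun v : ℝ => δ⁻¹ * q (v / δ) :=
    ((hq.contDiff.continuous.integrable_of_hasCompactSupport hq.hasCompactSupport).comp_div
      hδ.ne').const_mul _
  have htot : ∫ v : ℝ, δ⁻¹ * q (v / δ) = 1 := by
    rw [integral_const_mul, Measure.integral_comp_div q δ, hq.integral_eq_one, abs_of_pos hδ,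
      smul_eq_mul, mul_one, inv_mul_cancel₀ hδ.ne']
  have hterm : ∀ n : ℤ, ∫ v in (-(y : ℝ) + n)..(-(y : ℝ) + n + 1), δ⁻¹ * q (v / δ) =
      ∫ x : ℝ in Icc 0 1, δ⁻¹ * q ((x - y + n) / δ) := by
    intro n
    rw [integral_Icc_eq_integral_Ioc, ← intervalIntegral.integral_of_le zero_le_one]
    have := intervalIntegral.integral_comp_add_right (fun v => δ⁻¹ * q (v / δ)) (-(y : ℝ) + n)
      (a := 0) (b := 1)
    rw [zero_add, add_comm 1] at this
    rw [← this]
    simp only [sub_eq_add_neg, add_assoc]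
  have hsum := hint.hasSum_intervalIntegral (-(y : ℝ))
  rw [htot] at hsum
  simp only [hterm] at hsum
  have hfin := hasSum_sum_of_ne_finset_zero (L := .unconditional ℤ)
    (f := fun n : ℤ => ∫ x : ℝ in Icc 0 1, δ⁻¹ * q ((x - y + n) / δ))
    (s := Finset.Icc (-(⌈δ⌉ + 1)) (⌈δ⌉ + 1)) fun n hn => by
      refine setIntegral_eq_zero_of_forall_eq_zero fun x hx => ?_
      rw [hq.div_eq_zero hδ (sub_mem_Icc ⟨x, hx⟩ y) hn, mul_zero]
  rw [← hfin.unique hsum, ← integral_finsetSum]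
  · simp only [periodizedKernel_eq hq hδ]
    exact integral_subtype_comap measurableSet_Icc fun x : ℝ => periodizedProfile q δ (x - y)
  · intro n _
    have := hq.contDiff.continuous
    exact Continuous.integrableOn_Icc (by fun_prop)

/-- The oscillation is at most `2Lr`, and `r ≤ r ^ (1 / p)` for `0 < r ≤ 1`. -/
theorem memBV_of_lipschitzWith {p : ℝ} (hp : 1 ≤ p) {h : I → ℝ} {L : ℝ≥0}
    (hL : LipschitzWith L h) : MemBV p h := by
  refine ⟨hL.continuous.integrable_of_hasCompactSupport (HasCompactSupport.of_compactSpace h), ?_⟩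
  have hosc : ∀ r x, osc h r x ≤ ENNReal.ofReal (2 * L * r) := by
    intro r x
    refine iSup₂_le fun y₁ h₁ => iSup₂_le fun y₂ h₂ => ENNReal.ofReal_le_ofReal ?_
    rw [Metric.mem_ball] at h₁ h₂
    calc |h y₁ - h y₂| ≤ L * dist y₁ y₂ := hL.dist_le_mul y₁ y₂
      _ ≤ L * (r + r) := by
        gcongr
        exact (dist_triangle_right y₁ y₂ x).trans (add_le_add h₁.le h₂.le)
      _ = 2 * L * r := by ring
  refine lt_of_le_of_lt (iSup₂_le fun r hr => ?_) (ENNReal.ofReal_lt_top (r := 2 * L))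
  refine ENNReal.div_le_of_le_mul ?_
  rw [← ENNReal.ofReal_mul (by positivity)]
  have hr' : r ≤ r ^ (1 / p) := by
    simpa using Real.rpow_le_rpow_of_exponent_ge hr.1 hr.2
      ((div_le_one (zero_lt_one.trans_le hp)).2 hp)
  calc oscOne h r ≤ ∫⁻ _ : I, ENNReal.ofReal (2 * L * r) := lintegral_mono fun x => hosc r x
    _ = ENNReal.ofReal (2 * L * r) := by simp
    _ ≤ _ := ENNReal.ofReal_le_ofReal (by gcongr)

theorem continuous_periodizedKernel {q : ℝ → ℝ} (hq : IsNoiseKernel q) {δ : ℝ} (hδ : 0 < δ) :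
    Continuous (Function.uncurry (periodizedKernel q δ)) := by
  have := (contDiff_periodizedProfile hq δ).continuous
  simp only [Function.uncurry_def, periodizedKernel_eq hq hδ]
  fun_prop

theorem exists_lipschitzWith_periodizedKernel {q : ℝ → ℝ} (hq : IsNoiseKernel q) {δ : ℝ}
    (hδ : 0 < δ) : ∃ L : ℝ≥0, ∀ y, LipschitzWith L fun x => periodizedKernel q δ x y := by
  obtain ⟨L, hL⟩ := (contDiff_periodizedProfile hq δ).contDiffOn.exists_lipschitzOnWith
    one_ne_zero (convex_Icc (-1 : ℝ) 1) isCompact_Icc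
  refine ⟨L, fun y => LipschitzWith.of_dist_le_mul fun x x' => ?_⟩
  have := hL.dist_le_mul _ (sub_mem_Icc x y) _ (sub_mem_Icc x' y)
  rw [dist_sub_right] at this
  simpa only [periodizedKernel_eq hq hδ, Subtype.dist_eq] using this

theorem exists_periodizedKernel_mem_Icc {q : ℝ → ℝ} (hq : IsNoiseKernel q) {δ : ℝ}
    (hδ : 0 < δ) : ∃ C : ℝ, ∀ x y, periodizedKernel q δ x y ∈ Icc 0 C := by
  obtain ⟨C, hC⟩ := (isCompact_range (continuous_periodizedKernel hq hδ)).bddAbove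
  refine ⟨C, fun x y => ⟨?_, hC ⟨(x, y), rfl⟩⟩⟩
  rw [periodizedKernel_eq hq hδ]
  exact periodizedProfile_nonneg hq hδ _

end ExpandingMap

theorem mainTheorem2 (p s ε : ℝ) (hp : 1 ≤ p) (hε : 0 < ε)
    (τ : unitInterval → unitInterval) (hτ : ExpandingMap.MemT s ε τ)
    (q : ℝ → ℝ) (hq : ExpandingMap.IsNoiseKernel q) (δ : ℝ) (hδ : 0 < δ) :
    ∃ h : unitInterval → ℝ, ExpandingMap.MemBV p h ∧
      (∀ x, ExpandingMap.perturbedFP τ q δ h x = h x) ∧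
      (∀ x, 0 ≤ h x) ∧
      ∫ x : unitInterval, |h x| = 1 := by
  have hm := ExpandingMap.measurable_of_memT hτ
  have hac := ExpandingMap.map_volume_absolutelyContinuous hτ
  have hcont := ExpandingMap.continuous_periodizedKernel hq hδ
  obtain ⟨L, hL⟩ := ExpandingMap.exists_lipschitzWith_periodizedKernel hq hδ
  obtain ⟨C, hC⟩ := ExpandingMap.exists_periodizedKernel_mem_Icc hq hδ
  obtain ⟨h, hlip, h0, h1, hfix⟩ := ExpandingMap.exists_invariant_density
    (μ := (volume : Measure unitInterval))
    (K := fun x z => ExpandingMap.periodizedKernel q δ x (τ z))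
    (hcont.measurable.comp (measurable_fst.prodMk (hm.comp measurable_snd)))
    (fun x z => hC x (τ z)) (fun z => hL (τ z))
    (fun z => ExpandingMap.integral_periodizedKernel hq hδ (τ z))
  have hBV := ExpandingMap.memBV_of_lipschitzWith hp hlip
  refine ⟨h, hBV, fun x => ?_, h0, by simpa only [abs_of_nonneg (h0 _)] using h1⟩
  -- Duality is applied with `x` fixed and `g` the kernel section at `x`, so the equation holds at
  -- every point, although `P_τ h` is determined only almost everywhere.
  rw [← hfix x]
  exact ExpandingMap.integral_mul_frobeniusPerron hm hac hlip.continuous.measurable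
    hBV.integrable h0 (hcont.measurable.comp measurable_prodMk_left)
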